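/- For a real number $\beta>1$ let $T_\beta(x)=\{\beta x\}$ and $S_\beta(x)=1-\{\beta x\}$ for $x\in[0,1]$, where $\{y\}$ denotes the fractional part of $y$. Call $\beta$ a Parry number if the orbit $\{T_\beta^n(1):n\ge 0\}$ is finite, and a Yrrap number if the orbit $\{S_\beta^n(1):n\ge 0\}$ is finite. Let $P$ be the set of all Parry numbers, $Y$ the set of all Yrrap numbers, and write $A^c=\mathbb{R}\setminus A$. Then $P\cap Y^c$ and $P^c\cap Y$ are both countably infinite. Moreover, there are infinitely many $\beta\in P^c\cap Y$ that have a Galois conjugate over $\mathbb{Q}$, different from $\beta$, in the open interval $\bigl(1,\tfrac{1+\sqrt5}{2}\bigr)$. Furthermore, $P\cap Y^c$ is dense in $(1,\infty)$. -/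

import Mathlib

/-- The `β`-transformation `x ↦ {β x}`, a self-map of `[0, 1]`. -/
noncomputable def betaMap (β : ℝ) (x : ℝ) : ℝ := Int.fract (β * x)

/-- The negative `β`-transformation `x ↦ 1 - {β x}`, a self-map of `[0, 1]`. -/
noncomputable def negBetaMap (β : ℝ) (x : ℝ) : ℝ := 1 - Int.fract (β * x)

/-- The forward orbit `{T^n(x) : n ≥ 0}`. -/
def forwardOrbit (T : ℝ → ℝ) (x : ℝ) : Set ℝ := Set.range fun n : ℕ => T^[n] x

/-- The set of Parry numbers: the real `β > 1` for which the orbit of `1` under the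
`β`-transformation is finite. (Integers `β ≥ 2` belong to this set and to `yrrapNumbers`, so
they affect neither of the two set differences.) -/
def parryNumbers : Set ℝ := {β | 1 < β ∧ (forwardOrbit (betaMap β) 1).Finite}

/-- The set of Yrrap numbers: the real `β > 1` for which the orbit of `1` under the negative
`β`-transformation is finite. -/
def yrrapNumbers : Set ℝ := {β | 1 < β ∧ (forwardOrbit (negBetaMap β) 1).Finite}

/-!
If `T_β^n(1) = T_β^k(1)` with `n < k`, then `β` is a root of an integer polynomial `P_n - P_k`
built from the digits of `1`. The difference quotients of the `P_j` at `β` increase with `j`, so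
this polynomial has no other root in `(1, ∞)`. Likewise the polynomial attached to a Yrrap number
has no root in `(-∞, -1]`. Hence a second conjugate in `(1, ∞)` keeps `β` from being Parry, and a
conjugate in `(-∞, -1]` keeps it from being Yrrap. An explicit family of cubics yields Yrrap
numbers of the first kind.

For density, start from `b₀` with `T_{b₀}^r(1) = 0`; such `b₀` are dense. Appending sparse digits
`1` to the expansion of `1` in base `b₀` gives polynomials `f = X^n g - 1` with a root `b` slightly
larger than `b₀`, and `T_b` maps `1` to `0` in finitely many steps. With all the parameters even,
`f` also has a root `γ < -1`, and it remains to see that `b` and `γ` are conjugate. By Ljunggren's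
method this holds as soon as every `w` with `w w* = f f*` satisfies `f ∣ w` or `f ∣ w*`, where
`*` reverses the order of the coefficients. For large `n` one may pass to two variables,
replacing `f` by `X^n g Y^q - 1`, which is irreducible by Eisenstein's criterion.
-/

open Polynomial Filter Topology

/-! ### Orbits -/

theorem finite_forwardOrbit_iff {T : ℝ → ℝ} {x : ℝ} :
    (forwardOrbit T x).Finite ↔ ∃ n k, n < k ∧ T^[n] x = T^[k] x := by
  refine ⟨fun h => ?_, fun ⟨n, k, hnk, h⟩ => ?_⟩
  · exact h.exists_lt_map_eq_of_forall_mem fun n => Set.mem_range_self n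
  · have hper : Function.IsPeriodicPt T (k - n) (T^[n] x) := by
      rw [Function.IsPeriodicPt, Function.IsFixedPt, ← Function.iterate_add_apply,
        Nat.sub_add_cancel hnk.le, h]
    refine ((Set.finite_Iio k).image fun m => T^[m] x).subset ?_
    rintro _ ⟨m, rfl⟩
    obtain hm | hm := lt_or_ge m n
    · exact ⟨m, hm.trans hnk, rfl⟩
    · refine ⟨(m - n) % (k - n) + n, ?_, ?_⟩
      · have := Nat.mod_lt (m - n) (Nat.sub_pos_of_lt hnk)
        exact Set.mem_Iio.2 (by omega)
      · change T^[(m - n) % (k - n) + n] x = T^[m] x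
        rw [Function.iterate_add_apply, hper.iterate_mod_apply, ← Function.iterate_add_apply,
          Nat.sub_add_cancel hm]

theorem betaMap_eq {β x y : ℝ} (d : ℤ) (hy : 0 ≤ y) (hy' : y < 1) (h : β * x = d + y) :
    betaMap β x = y :=
  Int.fract_eq_iff.2 ⟨hy, hy', d, by rw [h]; ring⟩

theorem negBetaMap_eq {β x y : ℝ} (d : ℤ) (hy : 0 < y) (hy' : y ≤ 1) (h : β * x = d - y) :
    negBetaMap β x = y := by
  rw [negBetaMap, Int.fract_eq_iff.2 ⟨sub_nonneg.2 hy', by linarith, d - 1, by push_cast [h]; ring⟩,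
    sub_sub_cancel]

theorem betaMap_iterate_nonneg (β : ℝ) : ∀ k, 0 ≤ (betaMap β)^[k] 1
  | 0 => zero_le_one
  | k + 1 => by rw [Function.iterate_succ_apply']; exact Int.fract_nonneg _

theorem negBetaMap_iterate_pos (β : ℝ) : ∀ k, 0 < (negBetaMap β)^[k] 1
  | 0 => zero_lt_one
  | k + 1 => by rw [Function.iterate_succ_apply']; exact sub_pos.2 (Int.fract_lt_one _)

/-! ### Conjugates of Parry and Yrrap numbers -/

/-- The integer polynomial `P_k` with `P_k(β) = T_β^k(1)` obtained from the digits
`⌊β T_β^j(1)⌋`, `j < k`. -/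
noncomputable def betaPoly (β : ℝ) : ℕ → ℤ[X]
  | 0 => 1
  | k + 1 => X * betaPoly β k - C ⌊β * (betaMap β)^[k] 1⌋

/-- The integer polynomial `Q_k` with `Q_k(β) = S_β^k(1)` obtained from the digits
`⌊β S_β^j(1)⌋`, `j < k`. -/
noncomputable def negBetaPoly (β : ℝ) : ℕ → ℤ[X]
  | 0 => 1
  | k + 1 => -X * negBetaPoly β k + C (⌊β * (negBetaMap β)^[k] 1⌋ + 1)

theorem aeval_betaPoly_succ (β x : ℝ) (k : ℕ) :
    aeval x (betaPoly β (k + 1)) = x * aeval x (betaPoly β k) - ⌊β * (betaMap β)^[k] 1⌋ := by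
  simp [betaPoly]

theorem aeval_negBetaPoly_succ (β x : ℝ) (k : ℕ) :
    aeval x (negBetaPoly β (k + 1)) =
      -x * aeval x (negBetaPoly β k) + (⌊β * (negBetaMap β)^[k] 1⌋ + 1) := by
  simp [negBetaPoly]

theorem aeval_betaPoly (β : ℝ) : ∀ k, aeval β (betaPoly β k) = (betaMap β)^[k] 1
  | 0 => map_one _
  | k + 1 => by
    rw [aeval_betaPoly_succ, aeval_betaPoly β k, Function.iterate_succ_apply', betaMap, Int.fract]

theorem aeval_negBetaPoly (β : ℝ) : ∀ k, aeval β (negBetaPoly β k) = (negBetaMap β)^[k] 1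
  | 0 => map_one _
  | k + 1 => by
    rw [aeval_negBetaPoly_succ, aeval_negBetaPoly β k, Function.iterate_succ_apply', negBetaMap,
      Int.fract]
    ring

theorem slope_betaPoly_succ {β x : ℝ} (hx : x ≠ β) (k : ℕ) :
    slope (fun y => aeval y (betaPoly β (k + 1))) β x =
      x * slope (fun y => aeval y (betaPoly β k)) β x + (betaMap β)^[k] 1 := by
  have hx' : x - β ≠ 0 := sub_ne_zero.2 hx
  simp only [slope_def_field, aeval_betaPoly_succ, aeval_betaPoly]
  field_simp
  ring

theorem pow_le_slope_betaPoly_succ {β x : ℝ} (hx : x ≠ β) (hx₀ : 0 ≤ x) (k : ℕ) :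
    x ^ k ≤ slope (fun y => aeval y (betaPoly β (k + 1))) β x := by
  induction k with
  | zero => rw [slope_betaPoly_succ hx 0]; simp [slope_def_field, betaPoly]
  | succ k ih =>
    rw [slope_betaPoly_succ hx, pow_succ']
    exact le_add_of_le_of_nonneg (mul_le_mul_of_nonneg_left ih hx₀) (betaMap_iterate_nonneg β _)

theorem strictMono_slope_betaPoly {β x : ℝ} (hx : x ≠ β) (hx₁ : 1 < x) :
    StrictMono fun k => slope (fun y => aeval y (betaPoly β k)) β x := by
  refine strictMono_nat_of_lt_succ fun k => ?_
  obtain _ | k := k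
  · rw [slope_betaPoly_succ hx 0]
    simp [slope_def_field, betaPoly]
  · have hpos : 0 < slope (fun y => aeval y (betaPoly β (k + 1))) β x :=
      (pow_pos (zero_lt_one.trans hx₁) k).trans_le
        (pow_le_slope_betaPoly_succ hx (zero_lt_one.trans hx₁).le k)
    rw [slope_betaPoly_succ hx (k + 1)]
    exact (lt_mul_of_one_lt_left hpos hx₁).trans_le
      (le_add_of_nonneg_right (betaMap_iterate_nonneg β _))

theorem strictMono_aeval_negBetaPoly {β x : ℝ} (hβ : 0 ≤ β) (hx : x ≤ -1) :
    StrictMono fun k => aeval x (negBetaPoly β k) := by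
  have hdigit (k : ℕ) : (0 : ℝ) ≤ ⌊β * (negBetaMap β)^[k] 1⌋ := by
    exact_mod_cast Int.floor_nonneg.2 (mul_nonneg hβ (negBetaMap_iterate_pos β k).le)
  have hnonneg (k : ℕ) : 0 ≤ aeval x (negBetaPoly β k) := by
    induction k with
    | zero => simp [negBetaPoly]
    | succ k ih =>
      rw [aeval_negBetaPoly_succ]
      linarith [hdigit k, mul_nonneg (by linarith : 0 ≤ -x) ih]
  refine strictMono_nat_of_lt_succ fun k => ?_
  rw [aeval_negBetaPoly_succ]
  linarith [hdigit k, le_mul_of_one_le_left (hnonneg k) (by linarith : 1 ≤ -x)]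

theorem exists_aeval_eq_zero_of_mem_parryNumbers {β : ℝ} (h : β ∈ parryNumbers) :
    ∃ p : ℤ[X], aeval β p = 0 ∧ ∀ x : ℝ, x ≠ β → 1 < x → aeval x p ≠ 0 := by
  obtain ⟨n, k, hnk, heq⟩ := finite_forwardOrbit_iff.1 h.2
  refine ⟨betaPoly β n - betaPoly β k, ?_, fun x hx hx₁ h₀ => ?_⟩
  · rw [map_sub, aeval_betaPoly, aeval_betaPoly, heq, sub_self]
  · refine (strictMono_slope_betaPoly hx hx₁ hnk).ne ?_
    rw [map_sub, sub_eq_zero] at h₀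
    simp only [slope_def_field, aeval_betaPoly, h₀, heq]

theorem exists_aeval_eq_zero_of_mem_yrrapNumbers {β : ℝ} (h : β ∈ yrrapNumbers) :
    ∃ p : ℤ[X], aeval β p = 0 ∧ ∀ x : ℝ, x ≤ -1 → aeval x p ≠ 0 := by
  obtain ⟨n, k, hnk, heq⟩ := finite_forwardOrbit_iff.1 h.2
  refine ⟨negBetaPoly β n - negBetaPoly β k, ?_, fun x hx h₀ => ?_⟩
  · rw [map_sub, aeval_negBetaPoly, aeval_negBetaPoly, heq, sub_self]
  · rw [map_sub, sub_eq_zero] at h₀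
    exact (strictMono_aeval_negBetaPoly (zero_le_one.trans h.1.le) hx hnk).ne h₀

theorem countable_parryNumbers : parryNumbers.Countable := by
  refine (Algebraic.countable ℤ ℝ).mono fun β h => ?_
  obtain ⟨p, hp, hne⟩ := exists_aeval_eq_zero_of_mem_parryNumbers h
  refine ⟨p, ?_, hp⟩
  rintro rfl
  exact hne (β + 1) (by simp) (by linarith [h.1]) (map_zero _)

theorem countable_yrrapNumbers : yrrapNumbers.Countable := by
  refine (Algebraic.countable ℤ ℝ).mono fun β h => ?_
  obtain ⟨p, hp, hne⟩ := exists_aeval_eq_zero_of_mem_yrrapNumbers h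
  refine ⟨p, ?_, hp⟩
  rintro rfl
  exact hne (-1) le_rfl (map_zero _)

theorem aeval_eq_zero_of_isConjRoot {L : Type*} [Field L] [CharZero L] {x y : L}
    (h : IsConjRoot ℚ x y) {p : ℤ[X]} (hp : aeval x p = 0) : aeval y p = 0 := by
  rw [← aeval_map_algebraMap ℚ] at hp ⊢
  exact aeval_eq_zero_of_dvd_aeval_eq_zero (minpoly.dvd ℚ x hp) h.aeval_eq_zero

theorem notMem_parryNumbers_of_isConjRoot {β γ : ℝ} (h : IsConjRoot ℚ β γ) (hne : γ ≠ β)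
    (hγ : 1 < γ) : β ∉ parryNumbers := fun hβ =>
  have ⟨_, hp, hroot⟩ := exists_aeval_eq_zero_of_mem_parryNumbers hβ
  hroot γ hne hγ (aeval_eq_zero_of_isConjRoot h hp)

theorem notMem_yrrapNumbers_of_isConjRoot {β γ : ℝ} (h : IsConjRoot ℚ β γ) (hγ : γ ≤ -1) :
    β ∉ yrrapNumbers := fun hβ =>
  have ⟨_, hp, hroot⟩ := exists_aeval_eq_zero_of_mem_yrrapNumbers hβ
  hroot γ hγ (aeval_eq_zero_of_isConjRoot h hp)

/-! ### A family of Yrrap numbers -/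

/-- The cubic `X³ - N X² + X + (N - 1)`; for `N ≥ 4` its root in `(N - 1, N)` is a Yrrap
number with `S_β³(1) = S_β(1)`. -/
noncomputable def yrrapCubic (N : ℤ) : ℤ[X] := X ^ 3 - C N * X ^ 2 + X + C (N - 1)

theorem aeval_yrrapCubic (N : ℤ) (x : ℝ) :
    aeval x (yrrapCubic N) = x ^ 3 - N * x ^ 2 + x + (N - 1) := by
  simp [yrrapCubic]

theorem monic_yrrapCubic (N : ℤ) : (yrrapCubic N).Monic := by
  unfold yrrapCubic; monicity!

theorem irreducible_yrrapCubic {N : ℤ} (hN : Even N) : Irreducible (yrrapCubic N) := by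
  have hmap : (yrrapCubic N).map (Int.castRingHom (ZMod 2)) = X ^ 3 + X + 1 := by
    have hN' : (N : (ZMod 2)[X]) = 0 := by
      obtain ⟨m, rfl⟩ := hN
      push_cast
      exact CharTwo.add_self_eq_zero _
    simp [yrrapCubic, hN', CharTwo.neg_eq]
  refine (monic_yrrapCubic N).irreducible_of_irreducible_map (Int.castRingHom (ZMod 2)) _ ?_
  have hdeg : (X ^ 3 + X + 1 : (ZMod 2)[X]).natDegree = 3 := by compute_degree!
  rw [hmap]
  refine irreducible_of_degree_le_three_of_not_isRoot (by rw [hdeg]; decide) fun x => ?_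
  rw [IsRoot, eval_add, eval_add, eval_pow, eval_X, eval_one]
  revert x
  decide

theorem isConjRoot_of_irreducible {L : Type*} [Field L] [CharZero L] {p : ℤ[X]} (hp : p.Monic)
    (hirr : Irreducible p) {x y : L} (hx : aeval x p = 0) (hy : aeval y p = 0) :
    IsConjRoot ℚ x y := by
  have hmin {z : L} (hz : aeval z p = 0) : p.map (algebraMap ℤ ℚ) = minpoly ℚ z :=
    minpoly.eq_of_irreducible_of_monic (hp.irreducible_iff_irreducible_map_fraction_map.1 hirr)
      (by rwa [aeval_map_algebraMap]) (hp.map _)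
  exact (hmin hx).symm.trans (hmin hy)

theorem mem_yrrapNumbers_of_aeval_yrrapCubic {N : ℤ} (hN : 4 ≤ N) {β : ℝ} (hβ : (N : ℝ) - 1 < β)
    (hβ' : β < N) (h : aeval β (yrrapCubic N) = 0) : β ∈ yrrapNumbers := by
  have hN' : (4 : ℝ) ≤ N := by exact_mod_cast hN
  have hβ₀ : 0 < β := by linarith
  rw [aeval_yrrapCubic] at h
  have hy₀ : 0 < (1 - (N - β)) / β := div_pos (by linarith) hβ₀
  have hy₁ : (1 - (N - β)) / β ≤ 1 := (div_le_one hβ₀).2 (by linarith)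
  have h₁ : negBetaMap β 1 = N - β := negBetaMap_eq N (by linarith) (by linarith) (by ring)
  have h₂ : negBetaMap β (N - β) = (1 - (N - β)) / β :=
    negBetaMap_eq 2 hy₀ hy₁ (by push_cast; field_simp; linarith)
  have h₃ : negBetaMap β ((1 - (N - β)) / β) = N - β :=
    negBetaMap_eq 1 (by linarith) (by linarith) (by push_cast; field_simp)
  refine ⟨by linarith, finite_forwardOrbit_iff.2 ⟨1, 3, by decide, ?_⟩⟩
  simp only [Function.iterate_succ_apply, Function.iterate_zero_apply, h₁, h₂, h₃]

theorem exists_mem_yrrapNumbers_conj {N : ℤ} (hN : 4 ≤ N) (hN₂ : Even N) :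
    ∃ β : ℝ, (N : ℝ) - 1 < β ∧ β < N ∧ β ∈ parryNumbersᶜ ∩ yrrapNumbers ∧
      ∃ γ : ℝ, IsConjRoot ℚ β γ ∧ γ ≠ β ∧ 1 < γ ∧ γ < Real.goldenRatio := by
  have hN' : (4 : ℝ) ≤ N := by exact_mod_cast hN
  have hφ := Real.goldenRatio_sq
  have hφ₁ := Real.one_lt_goldenRatio
  have hφ₂ := Real.goldenRatio_lt_two
  have hcont : Continuous fun x : ℝ => aeval x (yrrapCubic N) := (yrrapCubic N).continuous_aeval
  obtain ⟨β, ⟨hβ, hβ'⟩, hβroot⟩ :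
      (0 : ℝ) ∈ (fun x : ℝ => aeval x (yrrapCubic N)) '' Set.Ioo (N - 1 : ℝ) N :=
    intermediate_value_Ioo (by linarith) hcont.continuousOn
      (by simp only [aeval_yrrapCubic]; constructor <;> nlinarith)
  obtain ⟨γ, ⟨hγ, hγ'⟩, hγroot⟩ :
      (0 : ℝ) ∈ (fun x : ℝ => aeval x (yrrapCubic N)) '' Set.Ioo 1 Real.goldenRatio :=
    intermediate_value_Ioo' hφ₁.le hcont.continuousOn
      (by simp only [aeval_yrrapCubic]; constructor <;> nlinarith)
  have hconj : IsConjRoot ℚ β γ :=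
    isConjRoot_of_irreducible (monic_yrrapCubic N) (irreducible_yrrapCubic hN₂) hβroot hγroot
  have hne : γ ≠ β := by linarith
  exact ⟨β, hβ, hβ', ⟨notMem_parryNumbers_of_isConjRoot hconj hne hγ,
    mem_yrrapNumbers_of_aeval_yrrapCubic hN hβ hβ' hβroot⟩, γ, hconj, hne, hγ, hγ'⟩

theorem infinite_yrrapNumbers_conj :
    {β : ℝ | β ∈ parryNumbersᶜ ∩ yrrapNumbers ∧
      ∃ γ : ℝ, IsConjRoot ℚ β γ ∧ γ ≠ β ∧ 1 < γ ∧ γ < Real.goldenRatio}.Infinite := by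
  choose f hf using fun n : ℕ =>
    exists_mem_yrrapNumbers_conj (N := 2 * (n + 2)) (by omega) (even_two_mul _)
  refine Set.infinite_of_injective_forall_mem (f := f) ?_ fun n => (hf n).2.2
  refine (strictMono_nat_of_lt_succ fun n => ?_).injective
  have hlt := (hf n).2.1
  have hgt := (hf (n + 1)).1
  push_cast at hlt hgt
  linarith

/-! ### Conjugate roots of `X ^ n * g - 1` -/

theorem exists_forall_abs_mul_sub_lt {ι : Type*} (E : Finset ι) (x : ι → ℝ) {m : ℕ} (hm : 0 < m) :
    ∃ q : ℕ, 1 ≤ q ∧ q ≤ m ^ E.card ∧ ∀ e ∈ E, ∃ z : ℤ, |q * x e - z| < 1 / m := by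
  classical
  have hm' : (0 : ℝ) < m := by exact_mod_cast hm
  let box (j : Fin (m ^ E.card + 1)) (e : E) : Fin m :=
    ⟨⌊m * Int.fract (j * x e)⌋₊, (Nat.floor_lt (mul_nonneg hm'.le (Int.fract_nonneg _))).2
      (mul_lt_of_lt_one_right hm' (Int.fract_lt_one _))⟩
  obtain ⟨i, j, hij, hbox⟩ : ∃ i j, i < j ∧ box i = box j := by
    obtain ⟨i, j, hne, hbox⟩ := Fintype.exists_ne_map_eq_of_card_lt box (by simp)
    obtain h | h := hne.lt_or_gt
    exacts [⟨i, j, h, hbox⟩, ⟨j, i, h, hbox.symm⟩]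
  have hij' : (i : ℕ) < j := hij
  refine ⟨j - i, by omega, by omega, fun e he => ⟨⌊j * x e⌋ - ⌊i * x e⌋, ?_⟩⟩
  have hfloor : ⌊m * Int.fract (j * x e)⌋ = ⌊m * Int.fract (i * x e)⌋ := by
    rw [← Int.natCast_floor_eq_floor (mul_nonneg hm'.le (Int.fract_nonneg _)),
      ← Int.natCast_floor_eq_floor (mul_nonneg hm'.le (Int.fract_nonneg _))]
    exact_mod_cast congrArg Fin.val (congrFun hbox ⟨e, he⟩).symm
  have hclose := Int.abs_sub_lt_one_of_floor_eq_floor hfloor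
  rw [← mul_sub, abs_mul, abs_of_pos hm', ← lt_div_iff₀' hm'] at hclose
  have hfract : ((j - i : ℕ) : ℝ) * x e - (⌊j * x e⌋ - ⌊i * x e⌋ : ℤ) =
      Int.fract (j * x e) - Int.fract (i * x e) := by
    rw [← Int.self_sub_floor, ← Int.self_sub_floor, Nat.cast_sub hij'.le, Int.cast_sub]
    ring
  rwa [hfract]

theorem round_eq_of_abs_sub_lt {x : ℝ} {z : ℤ} (h : |x - z| < 1 / 2) : round x = z :=
  round_eq_iff.2 ⟨by linarith [(abs_lt.1 h).1], by linarith [(abs_lt.1 h).2]⟩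

theorem toNat_round_add {x y : ℝ} (hx₀ : 0 ≤ x) (hy₀ : 0 ≤ y) {u v : ℤ} (hx : |x - u| < 1 / 4)
    (hy : |y - v| < 1 / 4) :
    (round (x + y)).toNat = (round x).toNat + (round y).toNat := by
  have hround_nonneg {t : ℝ} (ht : 0 ≤ t) : 0 ≤ round t := by
    rw [round_eq]; positivity
  rw [← Int.toNat_add (hround_nonneg hx₀) (hround_nonneg hy₀),
    round_eq_of_abs_sub_lt (hx.trans (by norm_num)),
    round_eq_of_abs_sub_lt (hy.trans (by norm_num)), round_eq_of_abs_sub_lt (z := u + v)]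
  rw [abs_lt] at *
  push_cast
  constructor <;> linarith

/-- A weight `ρ : ℕ → ℕ` that is additive on sums of two elements of a set `E` of exponents. -/
def IsAdditiveOn (ρ : ℕ → ℕ) (E : Finset ℕ) : Prop :=
  ∀ a ∈ E, ∀ b ∈ E, ρ (a + b) = ρ a + ρ b

/- The weight is `e ↦ round (q e / (n + l))`, where `q` is a denominator for which all the
`q e / (n + l)`, `e ∈ E`, are nearly integers. -/
theorem exists_isAdditiveOn (K l : ℕ) : ∃ N, ∀ n ≥ N, ∀ E : Finset ℕ, E.card ≤ K →
    ∃ (ρ : ℕ → ℕ) (q : ℕ), 0 < q ∧ ρ 0 = 0 ∧ (∀ e, n ≤ e → e ≤ n + l → ρ e = q) ∧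
      IsAdditiveOn ρ E := by
  refine ⟨2 * 4 ^ K * l + 1, fun n hn E hE => ?_⟩
  have hD : (0 : ℝ) < n + l := by exact_mod_cast (by omega : 0 < n + l)
  obtain ⟨q, hq₁, hqK, hq⟩ :=
    exists_forall_abs_mul_sub_lt E (fun e => (e : ℝ) / (n + l)) (m := 4) (by norm_num)
  refine ⟨fun e => (round (q * (e / (n + l)) : ℝ)).toNat, q, hq₁, by simp, fun e he he' => ?_,
    fun a ha b hb => ?_⟩
  · have hql : 2 * (q * l : ℝ) < n + l := by
      have : q ≤ 4 ^ K := hqK.trans (pow_le_pow_right₀ (by norm_num) hE)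
      have : 2 * (q * l) < n + l := by nlinarith
      exact_mod_cast this
    have hel : (n : ℝ) + l - e ≤ l := by
      have : (n : ℝ) ≤ e := by exact_mod_cast he
      linarith
    have he'' : (e : ℝ) ≤ n + l := by exact_mod_cast he'
    have hround : round (q * (e / (n + l)) : ℝ) = q := by
      refine round_eq_of_abs_sub_lt ?_
      have heq : q * (e / (n + l)) - ((q : ℤ) : ℝ) = -(q * (n + l - e) / (n + l) : ℝ) := by
        push_cast; field_simp; ring
      rw [heq, abs_neg, abs_of_nonneg (by have := sub_nonneg.2 he''; positivity), div_lt_iff₀ hD]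
      linarith [mul_le_mul_of_nonneg_left hel (Nat.cast_nonneg (α := ℝ) q)]
    exact (congrArg Int.toNat hround).trans (Int.toNat_natCast q)
  · obtain ⟨u, hu⟩ := hq a ha
    obtain ⟨v, hv⟩ := hq b hb
    have := toNat_round_add (by positivity) (by positivity) hu hv
    rwa [← mul_add, ← add_div, ← Nat.cast_add] at this

section WeightLift

variable {R : Type*} [CommSemiring R]

/-- The linear lift `X ^ e ↦ X ^ e * Y ^ (ρ e)` of polynomials in `X` to polynomials in `X` and
`Y`, the outer variable of `R[X][X]` playing the role of `Y`. -/
noncomputable def weightLift (ρ : ℕ → ℕ) : R[X] →ₗ[R] R[X][X] :=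
  lsum fun e => ((monomial (ρ e)).restrictScalars R).comp (monomial e)

variable (ρ : ℕ → ℕ)

@[simp]
theorem weightLift_monomial (e : ℕ) (a : R) :
    weightLift ρ (monomial e a) = monomial (ρ e) (monomial e a) := by
  simp [weightLift, lsum]

theorem eval_one_weightLift (p : R[X]) : (weightLift ρ p).eval 1 = p := by
  induction p using Polynomial.induction_on' with
  | add p q hp hq => rw [map_add, eval_add, hp, hq]
  | monomial e a => simp

variable {ρ}

theorem weightLift_eq_monomial {p : R[X]} {q : ℕ} (h : ∀ e ∈ p.support, ρ e = q) :
    weightLift ρ p = monomial q p := by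
  conv_lhs => rw [p.as_sum_support]
  conv_rhs => rw [p.as_sum_support]
  rw [map_sum, map_sum]
  exact Finset.sum_congr rfl fun e he => by rw [weightLift_monomial, h e he]

theorem weightLift_mul {E : Finset ℕ} (hρ : IsAdditiveOn ρ E) {p q : R[X]} (hp : p.support ⊆ E)
    (hq : q.support ⊆ E) : weightLift ρ (p * q) = weightLift ρ p * weightLift ρ q := by
  conv_lhs => rw [p.as_sum_support, q.as_sum_support]
  conv_rhs => rw [p.as_sum_support, q.as_sum_support]
  simp only [Finset.sum_mul_sum, map_sum]
  refine Finset.sum_congr rfl fun a ha => Finset.sum_congr rfl fun b hb => ?_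
  simp only [monomial_mul_monomial, weightLift_monomial, hρ a (hp ha) b (hq hb)]

end WeightLift

theorem irreducible_mirror_iff {R : Type*} [CommRing R] [NoZeroDivisors R] {p : R[X]} :
    Irreducible p.mirror ↔ Irreducible p :=
  let mirrorEquiv : R[X] ≃* R[X] :=
    ⟨mirror_involutive.toPerm, fun p q => mirror_mul_of_domain p q⟩
  MulEquiv.irreducible_iff mirrorEquiv

theorem irreducible_X_pow_sub_C_of_prime_dvd {R : Type*} [CommRing R] [IsDomain R] {a π : R}
    (hπ : Prime π) (hdvd : π ∣ a) (hsq : ¬π ^ 2 ∣ a) {q : ℕ} (hq : 0 < q) :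
    Irreducible (X ^ q - C a) := by
  have hmonic : (X ^ q - C a).Monic := monic_X_pow_sub_C a hq.ne'
  refine irreducible_of_eisenstein_criterion
    ((Ideal.span_singleton_prime hπ.ne_zero).2 hπ) ?_ (fun k hk => ?_) ?_ ?_ hmonic.isPrimitive
  · rw [hmonic.leadingCoeff, Ideal.mem_span_singleton]
    exact fun h => hπ.not_isUnit (isUnit_of_dvd_one h)
  · rw [degree_X_pow_sub_C hq, Nat.cast_lt] at hk
    rw [coeff_sub, coeff_X_pow, if_neg hk.ne, zero_sub, coeff_C, Ideal.mem_span_singleton, dvd_neg]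
    split_ifs
    exacts [hdvd, dvd_zero π]
  · rw [degree_X_pow_sub_C hq]
    exact_mod_cast hq
  · rw [Ideal.span_singleton_pow, Ideal.mem_span_singleton]
    simpa [hq.ne] using hsq

theorem irreducible_C_mul_X_pow_sub_one {R : Type*} [CommRing R] [IsDomain R] {a π : R}
    (hπ : Prime π) (hdvd : π ∣ a) (hsq : ¬π ^ 2 ∣ a) {q : ℕ} (hq : 0 < q) :
    Irreducible (C a * X ^ q - 1) := by
  have ha : a ≠ 0 := by rintro rfl; exact hsq (dvd_zero _)
  have hmirror : (X ^ q - C a).mirror = -(C a * X ^ q - 1) := by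
    have htrail : (X ^ q - C a).natTrailingDegree = 0 :=
      natTrailingDegree_eq_zero.2 (Or.inr (by simpa [hq.ne] using ha))
    rw [mirror, htrail, reverse, natDegree_X_pow_sub_C, reflect_sub, reflect_monomial, reflect_C,
      revAt_le le_rfl, Nat.sub_self]
    ring
  refine (Associated.refl (C a * X ^ q - 1)).neg_left.irreducible ?_
  rw [← hmirror, irreducible_mirror_iff]
  exact irreducible_X_pow_sub_C_of_prime_dvd hπ hdvd hsq hq

theorem card_support_le_sum_sq (p : ℤ[X]) : (p.support.card : ℤ) ≤ p.sum fun _ a => a ^ 2 := by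
  rw [sum_def, Finset.cast_card]
  exact Finset.sum_le_sum fun i hi => sq_pos_of_ne_zero (mem_support_iff.1 hi)

theorem sum_sq_eq_of_mul_mirror_eq {w f : ℤ[X]} (h : w * w.mirror = f * f.mirror) :
    (w.sum fun _ a => a ^ 2) = f.sum fun _ a => a ^ 2 := by
  have hdeg : w.natDegree = f.natDegree := by
    have := congrArg natDegree h
    rw [natDegree_mul_mirror, natDegree_mul_mirror] at this
    omega
  have htrail : w.natTrailingDegree = f.natTrailingDegree := by
    have := congrArg natTrailingDegree h
    rw [natTrailingDegree_mul_mirror, natTrailingDegree_mul_mirror] at this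
    omega
  rw [← coeff_mul_mirror, ← coeff_mul_mirror, h, hdeg, htrail]

theorem sum_sq_X_pow_mul_sub_one (g : ℤ[X]) {n : ℕ} (hn : 0 < n) :
    ((X ^ n * g - 1).sum fun _ a => a ^ 2) = 1 + g.sum fun _ a => a ^ 2 := by
  have hdeg : (X ^ n * g - 1).natDegree < n + (g.natDegree + 1) := by
    refine (natDegree_sub_le _ _).trans_lt (max_lt ?_ (by simp))
    exact natDegree_mul_le.trans_lt (by rw [natDegree_X_pow]; omega)
  have hlow : ∀ i ∈ Finset.range n, (X ^ n * g - 1).coeff i ^ 2 = if i = 0 then 1 else 0 := by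
    intro i hi
    rw [coeff_sub, coeff_X_pow_mul', if_neg (by simpa using hi), coeff_one]
    split_ifs <;> simp
  have hhigh (i : ℕ) : (X ^ n * g - 1).coeff (n + i) = g.coeff i := by
    rw [coeff_sub, add_comm n, coeff_X_pow_mul, coeff_one, if_neg (by omega), sub_zero]
  rw [sum_over_range' _ (by simp) _ hdeg, Finset.sum_range_add, Finset.sum_congr rfl hlow,
    Finset.sum_ite_eq' (Finset.range n) 0, if_pos (Finset.mem_range.2 hn),
    sum_over_range _ (by simp)]
  simp only [hhigh]

theorem weightLift_X_pow_mul_sub_one {R : Type*} [CommRing R] {g : R[X]} {ρ : ℕ → ℕ} {n q : ℕ}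
    (hρ₀ : ρ 0 = 0) (hρ : ∀ e, n ≤ e → e ≤ n + g.natDegree → ρ e = q) :
    weightLift ρ (X ^ n * g - 1) = C (X ^ n * g) * X ^ q - 1 := by
  have hlift : weightLift ρ (X ^ n * g) = monomial q (X ^ n * g) := by
    refine weightLift_eq_monomial fun e he => hρ e ?_ ?_
    · by_contra hlt
      exact mem_support_iff.1 he (by rw [coeff_X_pow_mul', if_neg hlt])
    · exact (le_natDegree_of_mem_supp e he).trans
        (natDegree_mul_le.trans (add_le_add_left (natDegree_X_pow_le n) _))
  rw [map_sub, hlift, ← C_mul_X_pow_eq_monomial, ← monomial_zero_one, weightLift_monomial, hρ₀,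
    monomial_zero_one, monomial_zero_one]

/- For large `n` all exponents of the four polynomials involved admit an additive weight that
vanishes at `0` and is constant on the exponents of `X ^ n * g`. Lifting by it turns
`w * w.mirror = f * f.mirror` into an identity in `ℤ[X][Y]` in which the lift of `f` is prime. -/
theorem exists_forall_dvd_or_dvd_mirror {g π : ℤ[X]} (hπ : Prime π) (hπX : ¬π ∣ X) (hdvd : π ∣ g)
    (hsq : ¬π ^ 2 ∣ g) : ∃ N, ∀ n ≥ N, ∀ w : ℤ[X],
      w * w.mirror = (X ^ n * g - 1) * (X ^ n * g - 1).mirror →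
        X ^ n * g - 1 ∣ w ∨ X ^ n * g - 1 ∣ w.mirror := by
  classical
  set K : ℤ := 1 + g.sum fun _ a => a ^ 2
  obtain ⟨N, hN⟩ := exists_isAdditiveOn (4 * K.toNat) g.natDegree
  refine ⟨N + 1, fun n hn w hw => ?_⟩
  set f : ℤ[X] := X ^ n * g - 1
  have hsum : (f.sum fun _ a => a ^ 2) = K := sum_sq_X_pow_mul_sub_one g (by omega)
  have hcard {u : ℤ[X]} (hu : u * u.mirror = f * f.mirror) : u.support.card ≤ K.toNat := by
    have := card_support_le_sum_sq u
    rw [sum_sq_eq_of_mul_mirror_eq hu, hsum] at this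
    omega
  have hmirror {u : ℤ[X]} (hu : u * u.mirror = f * f.mirror) :
      u.mirror * u.mirror.mirror = f * f.mirror := by
    rw [mirror_mirror, mul_comm, hu]
  obtain ⟨ρ, q, hq, hρ₀, hρq, hρ⟩ := hN n (by omega)
    ((w.support ∪ w.mirror.support) ∪ (f.support ∪ f.mirror.support)) <| by
      have := hcard hw
      have := hcard (hmirror hw)
      have := hcard (u := f) rfl
      have := hcard (hmirror (u := f) rfl)
      grw [Finset.card_union_le, Finset.card_union_le, Finset.card_union_le]
      omega
  have hirr : Irreducible (C (X ^ n * g) * X ^ q - 1) :=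
    irreducible_C_mul_X_pow_sub_one hπ (hdvd.mul_left _)
      (fun h => hsq (hπ.pow_dvd_of_dvd_mul_left 2 (fun h' => hπX (hπ.dvd_of_dvd_pow h')) h)) hq
  rw [← weightLift_X_pow_mul_sub_one hρ₀ hρq] at hirr
  have hlift : weightLift ρ f ∣ weightLift ρ w * weightLift ρ w.mirror := by
    rw [← weightLift_mul hρ (by grind) (by grind), hw, weightLift_mul hρ (by grind) (by grind)]
    exact dvd_mul_right _ _
  have hdvd_of_lift {u : ℤ[X]} (hu : weightLift ρ f ∣ weightLift ρ u) : f ∣ u := by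
    simpa only [coe_evalRingHom, eval_one_weightLift] using _root_.map_dvd (evalRingHom 1) hu
  exact (hirr.prime.dvd_or_dvd hlift).imp hdvd_of_lift hdvd_of_lift

theorem natDegree_X_pow_mul_sub_C {R : Type*} [Ring R] [Nontrivial R] {g : R[X]} (hg : g.Monic)
    (n : ℕ) (c : R) : (X ^ n * g - C c).natDegree = n + g.natDegree := by
  rw [natDegree_sub_C, (monic_X_pow n).natDegree_mul hg, natDegree_X_pow]

theorem monic_X_pow_mul_sub_C {R : Type*} [Ring R] [Nontrivial R] {g : R[X]} (hg : g.Monic)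
    {n : ℕ} (hn : 0 < n) (c : R) : (X ^ n * g - C c).Monic := by
  have hmonic : (X ^ n * g).Monic := (monic_X_pow n).mul hg
  refine hmonic.sub_of_left (degree_C_le.trans_lt ?_)
  rw [degree_eq_natDegree hmonic.ne_zero, (monic_X_pow n).natDegree_mul hg, natDegree_X_pow]
  exact_mod_cast Nat.add_pos_left hn _

section Conjugates

variable {L : Type*} [Field L]

theorem aeval_mirror_eq_zero_iff {p : ℤ[X]} {x : L} (hx : x ≠ 0) :
    aeval x p.mirror = 0 ↔ aeval x⁻¹ p = 0 := by
  let _ : Invertible x⁻¹ := invertibleOfNonzero (inv_ne_zero hx)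
  have h := eval₂_reverse_eq_zero_iff (algebraMap ℤ L) x⁻¹ p
  rw [invOf_eq_inv, inv_inv] at h
  rw [mirror, map_mul, map_pow, aeval_X, mul_eq_zero, or_iff_left (pow_ne_zero _ hx)]
  exact h

variable [CharZero L]

theorem exists_prime_dvd_of_simple_root {g : ℤ[X]} (hg : g.Monic) {β : L} (hβ₀ : β ≠ 0)
    (hβ : aeval β g = 0) (hβ' : aeval β (derivative g) ≠ 0) :
    ∃ π : ℤ[X], Prime π ∧ ¬π ∣ X ∧ π ∣ g ∧ ¬π ^ 2 ∣ g := by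
  have hint : IsIntegral ℤ β := ⟨g, hg, hβ⟩
  refine ⟨minpoly ℤ β, minpoly.prime_of_isIntegrallyClosed hint, fun h => hβ₀ ?_,
    minpoly.isIntegrallyClosed_dvd hint hβ, fun h => hβ' ?_⟩
  · simpa only [aeval_X] using aeval_eq_zero_of_dvd_aeval_eq_zero h (minpoly.aeval ℤ β)
  · have hdvd : minpoly ℤ β ∣ derivative g := by
      simpa only [Nat.add_one_sub_one, pow_one] using pow_sub_one_dvd_derivative_of_pow_dvd h
    exact aeval_eq_zero_of_dvd_aeval_eq_zero hdvd (minpoly.aeval ℤ β)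

/- Write `f = m * q` with `m` the minimal polynomial of `x`. If `m` did not vanish at `y`, then
`w = m * q.mirror` would contradict the hypothesis on `f`. -/
theorem isConjRoot_of_forall_dvd_or_dvd_mirror {f : ℤ[X]} (hf : f.Monic)
    (hfactor : ∀ w : ℤ[X], w * w.mirror = f * f.mirror → f ∣ w ∨ f ∣ w.mirror) {x y : L}
    (hx₀ : x ≠ 0) (hy₀ : y ≠ 0) (hx : aeval x f = 0) (hy : aeval y f = 0)
    (hx' : aeval x⁻¹ f ≠ 0) (hy' : aeval y⁻¹ f ≠ 0) : IsConjRoot ℚ x y := by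
  have hint : IsIntegral ℤ x := ⟨f, hf, hx⟩
  obtain ⟨q, rfl⟩ : minpoly ℤ x ∣ f := minpoly.isIntegrallyClosed_dvd hint hx
  set m := minpoly ℤ x
  have hm : aeval x m = 0 := minpoly.aeval ℤ x
  refine isConjRoot_of_irreducible (minpoly.monic hint) (minpoly.irreducible hint) hm
    (not_ne_iff.1 fun hmy => ?_)
  have hqy : aeval y q = 0 :=
    (mul_eq_zero.1 ((map_mul (aeval y) m q).symm.trans hy)).resolve_left hmy
  have hmirror : m * q.mirror * (m * q.mirror).mirror = m * q * (m * q).mirror := by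
    rw [mirror_mul_of_domain, mirror_mul_of_domain, mirror_mirror]
    ring
  obtain h | h := hfactor _ hmirror
  · have hq : q ∣ q.mirror := (mul_dvd_mul_iff_left (left_ne_zero_of_mul hf.ne_zero)).1 h
    refine hy' (aeval_eq_zero_of_dvd_aeval_eq_zero (dvd_mul_left q m) ?_)
    exact (aeval_mirror_eq_zero_iff hy₀).1 (aeval_eq_zero_of_dvd_aeval_eq_zero hq hqy)
  · rw [mirror_mul_of_domain, mirror_mirror] at h
    have hm' : m ∣ m.mirror := (mul_dvd_mul_iff_right (right_ne_zero_of_mul hf.ne_zero)).1 h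
    refine hx' (aeval_eq_zero_of_dvd_aeval_eq_zero (dvd_mul_right m q) ?_)
    exact (aeval_mirror_eq_zero_iff hx₀).1 (aeval_eq_zero_of_dvd_aeval_eq_zero hm' hm)

theorem exists_forall_isConjRoot {g : ℤ[X]} (hg : g.Monic) {β : L} (hβ₀ : β ≠ 0)
    (hβ : aeval β g = 0) (hβ' : aeval β (derivative g) ≠ 0) :
    ∃ N, ∀ n ≥ N, ∀ x y : L, aeval x (X ^ n * g - 1) = 0 → aeval y (X ^ n * g - 1) = 0 →
      aeval x⁻¹ (X ^ n * g - 1) ≠ 0 → aeval y⁻¹ (X ^ n * g - 1) ≠ 0 → IsConjRoot ℚ x y := by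
  obtain ⟨π, hπ, hπX, hdvd, hsq⟩ := exists_prime_dvd_of_simple_root hg hβ₀ hβ hβ'
  obtain ⟨N, hN⟩ := exists_forall_dvd_or_dvd_mirror hπ hπX hdvd hsq
  refine ⟨N + 1, fun n hn x y hx hy => ?_⟩
  have hne_zero {z : L} (hz : aeval z (X ^ n * g - 1) = 0) : z ≠ 0 := by
    rintro rfl
    simp [zero_pow (by omega : n ≠ 0)] at hz
  have hmonic : (X ^ n * g - 1).Monic := by
    simpa using monic_X_pow_mul_sub_C hg (by omega : 0 < n) 1
  exact isConjRoot_of_forall_dvd_or_dvd_mirror hmonic (hN n (by omega)) (hne_zero hx) (hne_zero hy)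
    hx hy

end Conjugates

/-! ### Digit polynomials -/

/-- Polynomials `X^m - d_{m-1} X^(m-1) - ⋯ - d_0` with digits `d_i ≥ 0`, generated by appending
a block of `n` digits all of which vanish except possibly the last one, `c`. -/
inductive IsDigitPoly : ℤ[X] → Prop
  | one : IsDigitPoly 1
  | X_pow_mul_sub_C {p : ℤ[X]} {n : ℕ} {c : ℤ} (hp : IsDigitPoly p) (hn : 0 < n) (hc : 0 ≤ c) :
      IsDigitPoly (X ^ n * p - C c)

theorem IsDigitPoly.monic {p : ℤ[X]} (hp : IsDigitPoly p) : p.Monic := by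
  induction hp with
  | one => exact monic_one
  | X_pow_mul_sub_C _ hn _ ih => exact monic_X_pow_mul_sub_C ih hn _

theorem aeval_X_pow_mul_sub_C (n : ℕ) (p : ℤ[X]) (c : ℤ) (x : ℝ) :
    aeval x (X ^ n * p - C c) = x ^ n * aeval x p - c := by
  simp

theorem IsDigitPoly.aeval_le_one {p : ℤ[X]} (hp : IsDigitPoly p) {x : ℝ} (hx : 0 ≤ x)
    (hx' : x ≤ 1) : aeval x p ≤ 1 := by
  induction hp with
  | one => simp
  | @X_pow_mul_sub_C p n c _ _ hc ih =>
    have hc' : (0 : ℝ) ≤ c := by exact_mod_cast hc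
    have hmul : x ^ n * aeval x p ≤ 1 :=
      (mul_le_of_le_one_right (pow_nonneg hx n) ih).trans (pow_le_one₀ hx hx')
    rw [aeval_X_pow_mul_sub_C]
    linarith

theorem IsDigitPoly.aeval_add_mul_derivative_pos {p : ℤ[X]} (hp : IsDigitPoly p) {x : ℝ}
    (hx : 0 < x) (h : 0 ≤ aeval x p) : 0 < aeval x p + x * aeval x (derivative p) := by
  induction hp with
  | one => simp
  | @X_pow_mul_sub_C p n c _ hn hc ih =>
    have hc' : (0 : ℝ) ≤ c := by exact_mod_cast hc
    obtain ⟨m, rfl⟩ := Nat.exists_eq_add_of_le' hn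
    have hxm : 0 < x ^ (m + 1) := pow_pos hx _
    refine add_pos_of_nonneg_of_pos h ?_
    rw [aeval_X_pow_mul_sub_C] at h
    have hp₀ : 0 ≤ aeval x p :=
      nonneg_of_mul_nonneg_right (hc'.trans (sub_nonneg.1 h)) hxm
    have hderiv : x * aeval x (derivative (X ^ (m + 1) * p - C c)) =
        x ^ (m + 1) * (m * aeval x p + (aeval x p + x * aeval x (derivative p))) := by
      simp only [eq_intCast, derivative_sub, derivative_mul, derivative_X_pow_succ,
        derivative_intCast, sub_zero, map_add, map_mul, map_natCast, map_one, map_pow, aeval_X]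
      ring
    rw [hderiv]
    exact mul_pos hxm (add_pos_of_nonneg_of_pos (mul_nonneg m.cast_nonneg hp₀) (ih hp₀))

theorem IsDigitPoly.aeval_derivative_ne_zero {p : ℤ[X]} (hp : IsDigitPoly p) {x : ℝ} (hx : 0 < x)
    (h : aeval x p = 0) : aeval x (derivative p) ≠ 0 := fun h' => by
  simpa [h, h'] using hp.aeval_add_mul_derivative_pos hx h.ge

theorem isDigitPoly_betaPoly {β : ℝ} (hβ : 0 ≤ β) : ∀ k, IsDigitPoly (betaPoly β k)
  | 0 => .one
  | k + 1 => by
    rw [betaPoly, ← pow_one X]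
    exact (isDigitPoly_betaPoly hβ k).X_pow_mul_sub_C one_pos
      (Int.floor_nonneg.2 (mul_nonneg hβ (betaMap_iterate_nonneg β k)))

theorem natDegree_betaPoly {β : ℝ} (hβ : 0 ≤ β) (k : ℕ) : (betaPoly β k).natDegree = k := by
  induction k with
  | zero => simp [betaPoly]
  | succ k ih =>
    rw [betaPoly, ← pow_one X, natDegree_X_pow_mul_sub_C (isDigitPoly_betaPoly hβ k).monic, ih,
      add_comm]

theorem exists_lt_aeval_eq_zero {p : ℤ[X]} (hp : p.Monic) (hdeg : Even p.natDegree) {a : ℝ}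
    (ha : aeval a p < 0) : ∃ x < a, aeval x p = 0 := by
  set q : ℝ[X] := (p.map (Int.castRingHom ℝ)).comp (-X) with hq
  have hq_eval (x : ℝ) : q.eval x = aeval (-x) p := by
    simp [hq, eval_map, aeval_def]
  have hq_monic : q.Monic := by
    have := (hp.map (Int.castRingHom ℝ)).neg_one_pow_natDegree_mul_comp_neg_X
    rwa [hp.natDegree_map, hdeg.neg_one_pow, one_mul] at this
  have hq_tendsto : Tendsto (fun x => q.eval x) atTop atTop := by
    refine q.tendsto_atTop_of_leadingCoeff_nonneg (not_le.1 fun hdeg₀ => ?_)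
      (hq_monic.leadingCoeff.symm ▸ zero_le_one)
    rw [hq_monic.degree_le_zero_iff_eq_one] at hdeg₀
    have := hq_eval (-a)
    simp only [hdeg₀, eval_one, neg_neg] at this
    linarith
  obtain ⟨y, hy, hay⟩ := ((hq_tendsto.eventually_gt_atTop 0).and
    (eventually_gt_atTop (-a))).exists
  rw [hq_eval] at hy
  obtain ⟨x, hx, hx₀⟩ := intermediate_value_Ioo' (by linarith : -y ≤ a)
    p.continuous_aeval.continuousOn ⟨ha, hy⟩
  exact ⟨x, hx.2, hx₀⟩

/-- The polynomial obtained from `p` by appending `K` blocks of `M` digits `0 ⋯ 0 1`. -/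
noncomputable def appendOnes (M K : ℕ) (p : ℤ[X]) : ℤ[X] := (fun q => X ^ M * q - C 1)^[K] p

theorem appendOnes_zero (M : ℕ) (p : ℤ[X]) : appendOnes M 0 p = p := rfl

theorem appendOnes_succ (M K : ℕ) (p : ℤ[X]) :
    appendOnes M (K + 1) p = X ^ M * appendOnes M K p - C 1 :=
  Function.iterate_succ_apply' _ _ _

theorem aeval_appendOnes_succ (M K : ℕ) (p : ℤ[X]) (x : ℝ) :
    aeval x (appendOnes M (K + 1) p) = x ^ M * aeval x (appendOnes M K p) - 1 := by
  rw [appendOnes_succ, aeval_X_pow_mul_sub_C, Int.cast_one]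

theorem IsDigitPoly.appendOnes {M : ℕ} (hM : 0 < M) {p : ℤ[X]} (hp : IsDigitPoly p) (K : ℕ) :
    IsDigitPoly (appendOnes M K p) := by
  induction K with
  | zero => exact hp
  | succ K ih => exact appendOnes_succ M K p ▸ ih.X_pow_mul_sub_C hM zero_le_one

theorem even_natDegree_appendOnes {M : ℕ} (hM : 0 < M) (hM' : Even M) {p : ℤ[X]}
    (hp : IsDigitPoly p) (hdeg : Even p.natDegree) (K : ℕ) :
    Even (appendOnes M K p).natDegree := by
  induction K with
  | zero => exact hdeg
  | succ K ih =>
    rw [appendOnes_succ, natDegree_X_pow_mul_sub_C (hp.appendOnes hM K).monic]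
    exact hM'.add ih

theorem aeval_appendOnes_nonpos {M : ℕ} {p : ℤ[X]} {x : ℝ} (hx : 0 ≤ x) (hp : aeval x p ≤ 0)
    (K : ℕ) : aeval x (appendOnes M K p) ≤ 0 := by
  induction K with
  | zero => exact hp
  | succ K ih =>
    rw [aeval_appendOnes_succ]
    linarith [mul_nonpos_of_nonneg_of_nonpos (pow_nonneg hx M) ih]

theorem le_aeval_appendOnes {M : ℕ} {p : ℤ[X]} {x y : ℝ} (hx : 0 ≤ x) (hy : 1 + y ≤ x ^ M * y)
    (hp : y ≤ aeval x p) (K : ℕ) : y ≤ aeval x (appendOnes M K p) := by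
  induction K with
  | zero => exact hp
  | succ K ih =>
    rw [aeval_appendOnes_succ]
    linarith [mul_le_mul_of_nonneg_left ih (pow_nonneg hx M)]

theorem aeval_appendOnes_le {M : ℕ} {p : ℤ[X]} {x B : ℝ} (hx : 0 ≤ x ^ M) (hx' : x ^ M ≤ 1)
    (hp : aeval x p ≤ B) (K : ℕ) : aeval x (appendOnes M K p) ≤ (x ^ M) ^ K * (B - K) := by
  induction K with
  | zero => simpa [appendOnes_zero] using hp
  | succ K ih =>
    have hpow : (x ^ M) ^ (K + 1) ≤ 1 := pow_le_one₀ hx hx'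
    calc aeval x (appendOnes M (K + 1) p) = x ^ M * aeval x (appendOnes M K p) - 1 :=
          aeval_appendOnes_succ M K p x
      _ ≤ x ^ M * ((x ^ M) ^ K * (B - K)) - (x ^ M) ^ (K + 1) := by gcongr
      _ = (x ^ M) ^ (K + 1) * (B - (K + 1 : ℕ)) := by push_cast; ring

theorem exists_appendOnes_nonpos (p : ℤ[X]) :
    ∃ K, ∀ M, Even M → ∀ x ∈ Set.Icc (-1 : ℝ) 0, aeval x (appendOnes M K p) ≤ 0 := by
  obtain ⟨B, hB⟩ := isCompact_Icc.bddAbove_image (K := Set.Icc (-1 : ℝ) 0)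
    p.continuous_aeval.continuousOn
  obtain ⟨K, hK⟩ := exists_nat_ge B
  refine ⟨K, fun M hM x hx => ?_⟩
  have hpK : aeval x p ≤ K := (hB ⟨x, hx, rfl⟩).trans hK
  have hpow : x ^ M ≤ 1 := by
    rw [← hM.neg_pow]
    exact pow_le_one₀ (neg_nonneg.2 hx.2) (neg_le.1 hx.1)
  simpa using aeval_appendOnes_le (hM.pow_nonneg x) hpow hpK K

theorem exists_forall_notMem_yrrapNumbers {g : ℤ[X]} (hg : IsDigitPoly g) {β : ℝ} (hβ : 0 < β)
    (hgβ : aeval β g = 0) (hdeg : Even g.natDegree)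
    (hneg : ∀ x ∈ Set.Icc (-1 : ℝ) 0, aeval x g ≤ 0) :
    ∃ N, ∀ n ≥ N, Even n → ∀ b : ℝ, 1 < b → aeval b (X ^ n * g - 1) = 0 → b ∉ yrrapNumbers := by
  obtain ⟨N, hN⟩ :=
    exists_forall_isConjRoot hg.monic hβ.ne' hgβ (hg.aeval_derivative_ne_zero hβ hgβ)
  refine ⟨N + 1, fun n hn hn' b hb hfb => ?_⟩
  have hn₀ : 0 < n := by omega
  have hf (x : ℝ) : aeval x (X ^ n * g - 1) = x ^ n * aeval x g - 1 := by simp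
  have hf_neg {x : ℝ} (hx : x ∈ Set.Icc (-1 : ℝ) 0) : aeval x (X ^ n * g - 1) < 0 := by
    rw [hf]
    linarith [mul_nonpos_of_nonneg_of_nonpos (hn'.pow_nonneg x) (hneg x hx)]
  have hf_monic : (X ^ n * g - 1).Monic := by simpa using monic_X_pow_mul_sub_C hg.monic hn₀ 1
  have hf_deg : Even (X ^ n * g - 1).natDegree := by
    rw [← C_1, natDegree_X_pow_mul_sub_C hg.monic]
    exact hn'.add hdeg
  obtain ⟨γ, hγ, hfγ⟩ :=
    exists_lt_aeval_eq_zero hf_monic hf_deg (hf_neg ⟨le_rfl, neg_one_lt_zero.le⟩)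
  have hfb_inv : aeval b⁻¹ (X ^ n * g - 1) < 0 := by
    have hb₀ : 0 ≤ b⁻¹ := (inv_pos.2 (zero_lt_one.trans hb)).le
    have hb₁ : b⁻¹ < 1 := inv_lt_one_of_one_lt₀ hb
    have := mul_le_of_le_one_right (pow_nonneg hb₀ n) (hg.aeval_le_one hb₀ hb₁.le)
    rw [hf]
    linarith [pow_lt_one₀ hb₀ hb₁ hn₀.ne']
  have hfγ_inv : aeval γ⁻¹ (X ^ n * g - 1) < 0 := by
    refine hf_neg ⟨?_, (inv_lt_zero.2 (by linarith)).le⟩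
    rw [← inv_neg_one]
    exact (inv_le_inv_of_neg neg_one_lt_zero (by linarith)).2 hγ.le
  exact notMem_yrrapNumbers_of_isConjRoot
    (hN n (by omega) b γ hfb hfγ hfb_inv.ne hfγ_inv.ne) hγ.le

/-! ### Density -/

theorem floor_eq_of_forall_fract_ne_zero {v : ℝ → ℝ} {a c : ℝ} (hv : ContinuousOn v (Set.Icc a c))
    (h : ∀ b ∈ Set.Icc a c, Int.fract (v b) ≠ 0) {s t : ℝ} (hs : s ∈ Set.Icc a c)
    (ht : t ∈ Set.Icc a c) : ⌊v s⌋ = ⌊v t⌋ := by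
  have hle {s t : ℝ} (hs : s ∈ Set.Icc a c) (ht : t ∈ Set.Icc a c) : ⌊v s⌋ ≤ ⌊v t⌋ := by
    by_contra! hlt
    obtain ⟨x, hx, hvx⟩ := isPreconnected_Icc.intermediate_value ht hs hv
      ⟨(Int.floor_lt.1 hlt).le, Int.floor_le (v s)⟩
    exact h x hx (by rw [hvx, Int.fract_intCast])
  exact (hle hs ht).antisymm (hle ht hs)

theorem pow_mul_sub_le_aeval_betaPoly_succ {β x : ℝ} (hβ : 0 ≤ β) (hx : β < x) (k : ℕ) :
    x ^ k * (x - β) ≤ aeval x (betaPoly β (k + 1)) - (betaMap β)^[k + 1] 1 := by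
  have h := pow_le_slope_betaPoly_succ hx.ne' (hβ.trans hx.le) k
  rwa [slope_def_field, le_div_iff₀ (sub_pos.2 hx), aeval_betaPoly] at h

theorem aeval_betaPoly_pos {β x : ℝ} (hβ : 0 ≤ β) (hx : β < x) : ∀ k, 0 < aeval x (betaPoly β k)
  | 0 => by simp [betaPoly]
  | k + 1 => by
    have hpow : 0 < x ^ k * (x - β) := mul_pos (pow_pos (hβ.trans_lt hx) k) (sub_pos.2 hx)
    linarith [pow_mul_sub_le_aeval_betaPoly_succ hβ hx k, betaMap_iterate_nonneg β (k + 1)]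

theorem betaMap_iterate_succ_lt_one (β : ℝ) (k : ℕ) : (betaMap β)^[k + 1] 1 < 1 := by
  rw [Function.iterate_succ_apply']
  exact Int.fract_lt_one _

theorem exists_betaMap_iterate_eq_zero {a c : ℝ} (ha : 0 ≤ a) (hac : a < c) (hc : 1 < c) :
    ∃ b ∈ Set.Icc a c, ∃ r, (betaMap b)^[r] 1 = 0 := by
  by_contra! hne
  have hiter (k : ℕ) : ∀ b ∈ Set.Icc a c, (betaMap b)^[k] 1 = aeval b (betaPoly a k) := by
    induction k with
    | zero => simp [betaPoly]
    | succ k ih =>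
      intro b hb
      have hfloor : ⌊b * aeval b (betaPoly a k)⌋ = ⌊a * aeval a (betaPoly a k)⌋ := by
        refine floor_eq_of_forall_fract_ne_zero (v := fun b => b * aeval b (betaPoly a k))
          (continuous_id.mul (betaPoly a k).continuous_aeval).continuousOn (fun b hb => ?_) hb
          (Set.left_mem_Icc.2 hac.le)
        have := hne b hb (k + 1)
        rwa [Function.iterate_succ_apply', ih b hb, betaMap] at this
      rw [Function.iterate_succ_apply', ih b hb, betaMap, Int.fract, hfloor, aeval_betaPoly_succ,
        aeval_betaPoly]
  obtain ⟨k, hk⟩ := pow_unbounded_of_one_lt (1 / (c - a)) hc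
  rw [div_lt_iff₀ (sub_pos.2 hac)] at hk
  have hgrowth := pow_mul_sub_le_aeval_betaPoly_succ ha hac k
  rw [← hiter _ c (Set.right_mem_Icc.2 hac.le)] at hgrowth
  linarith [betaMap_iterate_succ_lt_one c k, betaMap_iterate_nonneg a (k + 1)]

theorem eventually_betaMap_iterate_eq {β : ℝ} (hβ : 0 ≤ β) (k : ℕ) :
    ∀ᶠ b in 𝓝[>] β, (betaMap b)^[k] 1 = aeval b (betaPoly β k) := by
  induction k with
  | zero => simp [betaPoly]
  | succ k ih =>
    have hlt : ∀ᶠ b in 𝓝[>] β, aeval b (betaPoly β (k + 1)) < 1 :=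
      ((betaPoly β (k + 1)).continuous_aeval.continuousAt.eventually_lt_const
        (by simpa only [aeval_betaPoly] using betaMap_iterate_succ_lt_one β k)).filter_mono
          nhdsWithin_le_nhds
    filter_upwards [ih, hlt, self_mem_nhdsWithin] with b hb hb_lt (hβb : β < b)
    rw [Function.iterate_succ_apply', hb]
    exact betaMap_eq ⌊β * (betaMap β)^[k] 1⌋ (aeval_betaPoly_pos hβ hβb _).le hb_lt
      (by rw [aeval_betaPoly_succ]; ring)

theorem mem_parryNumbers_of_iterate_eq_zero {β : ℝ} (hβ : 1 < β) {r : ℕ}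
    (h : (betaMap β)^[r] 1 = 0) : β ∈ parryNumbers := by
  refine ⟨hβ, finite_forwardOrbit_iff.2 ⟨r, r + 1, r.lt_succ_self, ?_⟩⟩
  rw [Function.iterate_succ_apply', h, betaMap, mul_zero, Int.fract_zero]

theorem betaMap_iterate_of_pow_mul_lt_one {β y : ℝ} (hβ : 1 ≤ β) (hy : 0 ≤ y) (k : ℕ)
    (h : β ^ k * y < 1) : (betaMap β)^[k] y = β ^ k * y := by
  induction k with
  | zero => simp
  | succ k ih =>
    have hle : β ^ k * y ≤ β ^ (k + 1) * y := by gcongr; simp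
    rw [Function.iterate_succ_apply', ih (hle.trans_lt h)]
    exact betaMap_eq 0 (by positivity) h (by push_cast; ring)

theorem betaMap_iterate_eq_pow_mul_sub_one {β y : ℝ} (hβ : 1 < β) {k : ℕ} (hk : 0 < k)
    (h₁ : 1 ≤ β ^ k * y) (h₂ : β ^ k * y < 2) (hlt : β ^ k * y < β) :
    (betaMap β)^[k] y = β ^ k * y - 1 := by
  obtain ⟨j, rfl⟩ := Nat.exists_eq_add_of_le' hk
  have hβ₀ : 0 < β := zero_lt_one.trans hβ
  have hy : 0 ≤ y := (pos_of_mul_pos_right (zero_lt_one.trans_le h₁) (pow_pos hβ₀ _).le).le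
  have hj : β ^ j * y < 1 := by
    rw [pow_succ', mul_assoc] at hlt
    exact (mul_lt_iff_lt_one_right hβ₀).1 hlt
  rw [Function.iterate_succ_apply', betaMap_iterate_of_pow_mul_lt_one hβ.le hy j hj]
  exact betaMap_eq 1 (by linarith) (by linarith) (by push_cast; ring)

theorem exists_betaMap_iterate_eq_aeval_appendOnes {β : ℝ} (hβ : 1 < β) {M : ℕ} (hM : 0 < M)
    (hβM : 2 ≤ β ^ M * min 1 (β - 1)) (p : ℤ[X]) (K : ℕ) (h₀ : 0 ≤ aeval β (appendOnes M K p))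
    (hlt : aeval β (appendOnes M K p) < min 1 (β - 1)) :
    ∃ k, (betaMap β)^[k] (aeval β p) = aeval β (appendOnes M K p) := by
  induction K with
  | zero => exact ⟨0, rfl⟩
  | succ K ih =>
    have hβM₀ : 0 < β ^ M := pow_pos (zero_lt_one.trans hβ) M
    rw [aeval_appendOnes_succ] at h₀ hlt ⊢
    obtain ⟨hlt₁, hlt₂⟩ := lt_min_iff.1 hlt
    obtain ⟨k, hk⟩ := ih (pos_of_mul_pos_right (by linarith) hβM₀.le).le
      (lt_of_mul_lt_mul_left (by linarith) hβM₀.le)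
    refine ⟨M + k, ?_⟩
    rw [Function.iterate_add_apply, hk]
    exact betaMap_iterate_eq_pow_mul_sub_one hβ hM (by linarith) (by linarith) (by linarith)

theorem mem_parryNumbers_of_aeval_appendOnes {β : ℝ} (hβ : 1 < β) {p : ℤ[X]} {r : ℕ}
    (hp : (betaMap β)^[r] 1 = aeval β p) {M n : ℕ} (hM : 0 < M) (hMn : M ≤ n)
    (hβM : 2 ≤ β ^ M * min 1 (β - 1)) {K : ℕ} (h : aeval β (X ^ n * appendOnes M K p - 1) = 0) :
    β ∈ parryNumbers := by
  set y := aeval β (appendOnes M K p) with hy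
  have hy_eq : β ^ n * y = 1 := sub_eq_zero.1 (by simpa [hy] using h)
  have hβn : 0 < β ^ n := pow_pos (zero_lt_one.trans hβ) n
  have hy₀ : 0 ≤ y := (pos_of_mul_pos_right (hy_eq ▸ zero_lt_one) hβn.le).le
  have hy_lt : y < min 1 (β - 1) := by
    refine lt_of_mul_lt_mul_left ?_ hβn.le
    calc β ^ n * y < 2 := by linarith
      _ ≤ β ^ M * min 1 (β - 1) := hβM
      _ ≤ β ^ n * min 1 (β - 1) := by
        have : 0 < min 1 (β - 1) := lt_min one_pos (sub_pos.2 hβ)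
        gcongr
        exact hβ.le
  obtain ⟨k, hk⟩ := exists_betaMap_iterate_eq_aeval_appendOnes hβ hM hβM p K hy₀ hy_lt
  refine mem_parryNumbers_of_iterate_eq_zero hβ (r := n + (k + r)) ?_
  rw [Function.iterate_add_apply, Function.iterate_add_apply, hp, hk, ← hy,
    betaMap_iterate_eq_pow_mul_sub_one hβ (hM.trans_le hMn) hy_eq.ge (by linarith) (by linarith),
    hy_eq, sub_self]

theorem exists_even_le_pow_mul {b δ y : ℝ} (hb : 1 < b) (hδ : 0 < δ) (hy : 0 < y) :
    ∃ M, 0 < M ∧ Even M ∧ 2 ≤ b ^ M * δ ∧ 1 + y ≤ b ^ M * y := by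
  have hpow := tendsto_pow_atTop_atTop_of_one_lt hb
  have hlarge := ((eventually_gt_atTop 0).and
    ((hpow.atTop_mul_const hδ).eventually_ge_atTop 2)).and
      ((hpow.atTop_mul_const hy).eventually_ge_atTop (1 + y))
  obtain ⟨M, hM, ⟨hM₀, hMδ⟩, hMy⟩ := (Nat.frequently_even.and_eventually hlarge).exists
  exact ⟨M, hM₀, hM, hMδ, hMy⟩

theorem exists_aeval_X_pow_mul_sub_one_eq_zero {g : ℤ[X]} {a c : ℝ} (ha : 0 ≤ a) (hac : a < c)
    (hga : aeval a g ≤ 0) {n : ℕ} (hgc : 1 < c ^ n * aeval c g) :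
    ∃ b ∈ Set.Ioo a c, aeval b (X ^ n * g - 1) = 0 := by
  have hf (x : ℝ) : aeval x (X ^ n * g - 1) = x ^ n * aeval x g - 1 := by simp
  refine intermediate_value_Ioo hac.le (X ^ n * g - 1).continuous_aeval.continuousOn ⟨?_, ?_⟩
  · rw [hf]
    linarith [mul_nonpos_of_nonneg_of_nonpos (pow_nonneg ha n) hga]
  · rw [hf]
    exact sub_pos.2 hgc

theorem betaMap_iterate_add_eq_zero {β x : ℝ} {r : ℕ} (h : (betaMap β)^[r] x = 0) (k : ℕ) :
    (betaMap β)^[k + r] x = 0 := by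
  rw [Function.iterate_add_apply, h]
  exact Function.iterate_fixed (by rw [betaMap, mul_zero, Int.fract_zero]) k

theorem exists_aeval_appendOnes_eq_zero_notMem_yrrapNumbers {p : ℤ[X]} (hp : IsDigitPoly p)
    (hdeg : Even p.natDegree) {a c : ℝ} (ha : 1 < a) (hac : a < c) (hpa : aeval a p ≤ 0)
    (hpc : 0 < aeval c p) {M : ℕ} (hM : 0 < M) (hM_even : Even M)
    (hMp : 1 + aeval c p ≤ c ^ M * aeval c p) :
    ∃ K, ∃ n ≥ M, ∃ b ∈ Set.Ioo a c,
      aeval b (X ^ n * appendOnes M K p - 1) = 0 ∧ b ∉ yrrapNumbers := by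
  have ha₀ : 0 < a := zero_lt_one.trans ha
  obtain ⟨K, hK⟩ := exists_appendOnes_nonpos p
  set g := appendOnes M K p
  have hga : aeval a g ≤ 0 := aeval_appendOnes_nonpos ha₀.le hpa K
  have hgc : aeval c p ≤ aeval c g := le_aeval_appendOnes (ha₀.trans hac).le hMp le_rfl K
  obtain ⟨β, ⟨haβ, -⟩, hgβ⟩ := intermediate_value_Icc hac.le g.continuous_aeval.continuousOn
    ⟨hga, hpc.le.trans hgc⟩
  obtain ⟨N, hN⟩ := exists_forall_notMem_yrrapNumbers (hp.appendOnes hM K) (ha₀.trans_le haβ) hgβ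
    (even_natDegree_appendOnes hM hM_even hp hdeg K) (hK M hM_even)
  have hMn : M ≤ 2 * (M + N) := by omega
  have hfc : 1 < c ^ (2 * (M + N)) * aeval c g :=
    calc 1 < c ^ M * aeval c p := by linarith
      _ ≤ c ^ (2 * (M + N)) * aeval c g :=
        mul_le_mul (pow_le_pow_right₀ (ha.trans hac).le hMn) hgc hpc.le
          (pow_nonneg (ha₀.trans hac).le _)
  obtain ⟨b, hb, hfb⟩ := exists_aeval_X_pow_mul_sub_one_eq_zero ha₀.le hac hga hfc
  exact ⟨K, _, hMn, b, hb, hfb, hN _ (by omega) (even_two_mul _) b (ha.trans hb.1) hfb⟩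

theorem exists_mem_parryNumbers_notMem_yrrapNumbers {b₀ c : ℝ} (hb₀ : 1 < b₀) (hc : b₀ < c)
    {r : ℕ} (h : (betaMap b₀)^[r] 1 = 0) :
    ∃ b ∈ Set.Ioo b₀ c, b ∈ parryNumbers ∩ yrrapNumbersᶜ := by
  have hb₀_nonneg : 0 ≤ b₀ := zero_le_one.trans hb₀.le
  have hroot : aeval b₀ (betaPoly b₀ (r + r)) = 0 := by
    rw [aeval_betaPoly, betaMap_iterate_add_eq_zero h]
  obtain ⟨b₁, hb₁ : b₀ < b₁, hsub⟩ := mem_nhdsGT_iff_exists_Ioo_subset.1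
    ((eventually_betaMap_iterate_eq hb₀_nonneg (r + r)).and (Ioo_mem_nhdsGT hc))
  have hpos : 0 < aeval b₁ (betaPoly b₀ (r + r)) := aeval_betaPoly_pos hb₀_nonneg hb₁ _
  obtain ⟨M, hM, hM_even, hMδ, hMp⟩ :=
    exists_even_le_pow_mul hb₀ (lt_min one_pos (sub_pos.2 hb₀)) hpos
  obtain ⟨K, n, hMn, b, hb, hfb, hbY⟩ :=
    exists_aeval_appendOnes_eq_zero_notMem_yrrapNumbers (isDigitPoly_betaPoly hb₀_nonneg (r + r))
      (by rw [natDegree_betaPoly hb₀_nonneg]; exact ⟨r, rfl⟩) hb₀ hb₁ hroot.le hpos hM hM_even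
      (hMp.trans (by gcongr))
  obtain ⟨hit, hbc⟩ := hsub hb
  have hMδ' : 2 ≤ b ^ M * min 1 (b - 1) := by
    have : 0 ≤ min 1 (b₀ - 1) := (lt_min one_pos (sub_pos.2 hb₀)).le
    have hle : b₀ ≤ b := hb.1.le
    have hb_nonneg : 0 ≤ b := hb₀_nonneg.trans hle
    exact hMδ.trans (by gcongr)
  exact ⟨b, hbc, mem_parryNumbers_of_aeval_appendOnes (hb₀.trans hb.1) hit hM hMn hMδ' hfb, hbY⟩

theorem Ioi_one_subset_closure :
    Set.Ioi (1 : ℝ) ⊆ closure (parryNumbers ∩ yrrapNumbersᶜ) := by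
  intro x (hx : 1 < x)
  refine Metric.mem_closure_iff.2 fun ε hε => ?_
  obtain ⟨b₀, hb₀, r, hr⟩ :=
    exists_betaMap_iterate_eq_zero (by linarith) (by linarith : x < x + ε / 2) (by linarith)
  obtain ⟨b, hb, hmem⟩ := exists_mem_parryNumbers_notMem_yrrapNumbers (hx.trans_le hb₀.1)
    (by linarith : b₀ < b₀ + ε / 2) hr
  refine ⟨b, hmem, ?_⟩
  rw [Real.dist_eq, abs_sub_lt_iff]
  constructor <;> linarith [hb₀.1, hb₀.2, hb.1, hb.2]

theorem infinite_parryNumbers_inter_compl_yrrapNumbers :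
    (parryNumbers ∩ yrrapNumbersᶜ).Infinite := fun hfin => by
  have hsub := Ioi_one_subset_closure
  rw [hfin.isClosed.closure_eq] at hsub
  exact Set.Ioi_infinite (1 : ℝ) (hfin.subset hsub)

theorem theorem2p7 :
    ((parryNumbers ∩ yrrapNumbersᶜ).Countable ∧ (parryNumbers ∩ yrrapNumbersᶜ).Infinite) ∧
    ((parryNumbersᶜ ∩ yrrapNumbers).Countable ∧ (parryNumbersᶜ ∩ yrrapNumbers).Infinite) ∧
    {β : ℝ | β ∈ parryNumbersᶜ ∩ yrrapNumbers ∧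
      ∃ γ : ℝ, IsConjRoot ℚ β γ ∧ γ ≠ β ∧ 1 < γ ∧ γ < Real.goldenRatio}.Infinite ∧
    Set.Ioi (1 : ℝ) ⊆ closure (parryNumbers ∩ yrrapNumbersᶜ) :=
  ⟨⟨countable_parryNumbers.mono Set.inter_subset_left,
      infinite_parryNumbers_inter_compl_yrrapNumbers⟩,
    ⟨countable_yrrapNumbers.mono Set.inter_subset_right,
      infinite_yrrapNumbers_conj.mono fun _ h => h.1⟩,
    infinite_yrrapNumbers_conj, Ioi_one_subset_closure⟩
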